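/- For $n\ge 2$ let $VT_n$ be the virtual twin group, i.e. the group generated by $s_1,\dots,s_{n-1},\rho_1,\dots,\rho_{n-1}$ subject to the defining relations $s_i^2=\rho_i^2=1$ for $1\le i\le n-1$; $s_is_j=s_js_i$, $\rho_i\rho_j=\rho_j\rho_i$, $s_i\rho_j=\rho_js_i$ for $|i-j|\ge 2$; and $\rho_i\rho_j\rho_i=\rho_j\rho_i\rho_j$, $\rho_is_j\rho_i=\rho_js_i\rho_j$ for $|i-j|=1$. Let $VT_n'$ denote its commutator subgroup. Then the following hold. 1. $VT_2'\cong\mathbb{Z}$, and it is generated by $(\rho_1s_1)^2$. 2. $VT_3'\cong\mathbb{Z}_3*\mathbb{Z}_3*\mathbb{Z}$, and it has the presentation $$\big\langle \rho_2\rho_1,\ s_1\rho_2\rho_1s_1,\ (\rho_1s_1)^2 \;\big|\; (\rho_2\rho_1)^3=(s_1\rho_2\rho_1s_1)^3=1\big\rangle .$$ 3. For $n\ge 4$, put $x_i=\rho_i\rho_1$ for $2\le i\le n-1$, $z=s_1\rho_2\rho_1s_1$ and $w=(\rho_1s_1)^2$. Then $VT_n'$ has a presentation with generators $x_2,\dots,x_{n-1},z,w$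 and defining relations \begin{align*} x_2^3&=1,\\ x_j^2&=1 && \text{for } 3\le j\le n-1,\\ z^3&=1,\\ (x_ix_{i+1}^{-1})^3&=1 && \text{for } 2\le i\le n-2,\\ (x_ix_j^{-1})^2&=1 && \text{for } 2\le i\le n-2 \text{ and } i+2\le j\le n-1,\\ (x_jw)^2&=1 && \text{for } 3\le j\le n-1,\\ (zw^{-1}x_3^{-1})^3&=1,\\ (zw^{-1}x_j^{-1})^2&=1 && \text{for } 4\le j\le n-1,\\ (zw^{-1}x_3^{-1}z^{-1}x_2x_3x_2^{-1})^2&=1,\\ (wz^{-1}x_3wzw^{-1}x_2^{-1}x_3^{-1}x_2)^2&=1. \end{align*} -/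

import Mathlib

/-- Generators `s_i`, `ρ_i` (`1 ≤ i ≤ n - 1`) of the virtual twin group. -/
inductive VTGen (n : ℕ) : Type
  | s (i : {i : ℕ // 1 ≤ i ∧ i < n}) : VTGen n
  | ρ (i : {i : ℕ // 1 ≤ i ∧ i < n}) : VTGen n

/-- The letter `s_i` of the free group. -/
def VTGen.S {n : ℕ} (i : {i : ℕ // 1 ≤ i ∧ i < n}) : FreeGroup (VTGen n) :=
  FreeGroup.of (VTGen.s i)

/-- The letter `ρ_i` of the free group. -/
def VTGen.R {n : ℕ} (i : {i : ℕ // 1 ≤ i ∧ i < n}) : FreeGroup (VTGen n) :=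
  FreeGroup.of (VTGen.ρ i)

open VTGen in
/-- The defining relators of the virtual twin group; a relation `u = v` gives the relator
`u * v⁻¹`. -/
inductive IsVTRelator (n : ℕ) : FreeGroup (VTGen n) → Prop
  | s_sq (i : {i : ℕ // 1 ≤ i ∧ i < n}) : IsVTRelator n (S i ^ 2)
  | ρ_sq (i : {i : ℕ // 1 ≤ i ∧ i < n}) : IsVTRelator n (R i ^ 2)
  | s_comm (i j : {i : ℕ // 1 ≤ i ∧ i < n}) (h : 2 ≤ |((i : ℕ) : ℤ) - ((j : ℕ) : ℤ)|) :
      IsVTRelator n (S i * S j * (S j * S i)⁻¹)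
  | ρ_comm (i j : {i : ℕ // 1 ≤ i ∧ i < n}) (h : 2 ≤ |((i : ℕ) : ℤ) - ((j : ℕ) : ℤ)|) :
      IsVTRelator n (R i * R j * (R j * R i)⁻¹)
  | sρ_comm (i j : {i : ℕ // 1 ≤ i ∧ i < n}) (h : 2 ≤ |((i : ℕ) : ℤ) - ((j : ℕ) : ℤ)|) :
      IsVTRelator n (S i * R j * (R j * S i)⁻¹)
  | ρ_braid (i j : {i : ℕ // 1 ≤ i ∧ i < n}) (h : |((i : ℕ) : ℤ) - ((j : ℕ) : ℤ)| = 1) :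
      IsVTRelator n (R i * R j * R i * (R j * R i * R j)⁻¹)
  | mixed (i j : {i : ℕ // 1 ≤ i ∧ i < n}) (h : |((i : ℕ) : ℤ) - ((j : ℕ) : ℤ)| = 1) :
      IsVTRelator n (R i * S j * R i * (R j * S i * R j)⁻¹)

/-- The virtual twin group `VT_n`. -/
abbrev VT (n : ℕ) : Type :=
  PresentedGroup {r : FreeGroup (VTGen n) | IsVTRelator n r}

/-- The element `s_i` of `VT_n`, for `1 ≤ i ≤ n - 1`. -/
def VT.s {n : ℕ} (i : ℕ) (h : 1 ≤ i ∧ i < n := by omega) : VT n :=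
  PresentedGroup.of (VTGen.s ⟨i, h⟩)

/-- The element `ρ_i` of `VT_n`, for `1 ≤ i ≤ n - 1`. -/
def VT.ρ {n : ℕ} (i : ℕ) (h : 1 ≤ i ∧ i < n := by omega) : VT n :=
  PresentedGroup.of (VTGen.ρ ⟨i, h⟩)

/-- The subgroup `H` of `G` has the presentation `⟨α ∣ rels⟩`, where the abstract generator `a`
stands for the element `g a` of `G`. -/
def Subgroup.HasPresentation {G : Type*} [Group G] (H : Subgroup G) {α : Type*} (g : α → G)
    (rels : Set (FreeGroup α)) : Prop :=
  ∃ e : PresentedGroup rels ≃* H, ∀ a : α, ((e (PresentedGroup.of a) : H) : G) = g a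

/-- The generating symbols `x_i` (`2 ≤ i ≤ n - 1`), `z`, `w` for the commutator subgroup. -/
inductive VTCommGen (n : ℕ) : Type
  | x (i : {i : ℕ // 2 ≤ i ∧ i < n}) : VTCommGen n
  | z : VTCommGen n
  | w : VTCommGen n

namespace VTCommGen

/-- The letter `x_i` of the free group, for `2 ≤ i ≤ n - 1`. -/
def X {n : ℕ} (i : ℕ) (h : 2 ≤ i ∧ i < n := by omega) : FreeGroup (VTCommGen n) :=
  FreeGroup.of (x ⟨i, h⟩)

/-- The letter `z` of the free group. -/
def Z {n : ℕ} : FreeGroup (VTCommGen n) := FreeGroup.of z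

/-- The letter `w` of the free group. -/
def W {n : ℕ} : FreeGroup (VTCommGen n) := FreeGroup.of w

/-- The elements of `VT_n` for which the symbols stand:
`x_i = ρ_i ρ_1`, `z = s_1 ρ_2 ρ_1 s_1`, `w = (ρ_1 s_1)²`. -/
def toVT (n : ℕ) (hn : 3 ≤ n) : VTCommGen n → VT n
  | x ⟨i, _⟩ => VT.ρ i * VT.ρ 1
  | z => VT.s 1 * VT.ρ 2 * VT.ρ 1 * VT.s 1
  | w => (VT.ρ 1 * VT.s 1) ^ 2

/-- The ten families of relators, for `n ≥ 4`. -/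
inductive IsRelator (n : ℕ) (hn : 4 ≤ n) : FreeGroup (VTCommGen n) → Prop
  | rel1 : IsRelator n hn (X 2 ^ 3)
  | rel2 (j : ℕ) (h3 : 3 ≤ j) (hj : j < n) : IsRelator n hn (X j ^ 2)
  | rel3 : IsRelator n hn (Z ^ 3)
  | rel4 (i : ℕ) (h2 : 2 ≤ i) (hi : i + 1 < n) :
      IsRelator n hn ((X i * (X (i + 1))⁻¹) ^ 3)
  | rel5 (i j : ℕ) (h2 : 2 ≤ i) (hij : i + 2 ≤ j) (hj : j < n) :
      IsRelator n hn ((X i * (X j)⁻¹) ^ 2)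
  | rel6 (j : ℕ) (h3 : 3 ≤ j) (hj : j < n) : IsRelator n hn ((X j * W) ^ 2)
  | rel7 : IsRelator n hn ((Z * W⁻¹ * (X 3)⁻¹) ^ 3)
  | rel8 (j : ℕ) (h4 : 4 ≤ j) (hj : j < n) : IsRelator n hn ((Z * W⁻¹ * (X j)⁻¹) ^ 2)
  | rel9 : IsRelator n hn ((Z * W⁻¹ * (X 3)⁻¹ * Z⁻¹ * X 2 * X 3 * (X 2)⁻¹) ^ 2)
  | rel10 : IsRelator n hn
      ((W * Z⁻¹ * X 3 * W * Z * W⁻¹ * (X 2)⁻¹ * (X 3)⁻¹ * X 2) ^ 2)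

end VTCommGen

/-!
The relations `s_{i+1} = ρ_i ρ_{i+1} s_i ρ_{i+1} ρ_i` eliminate `s_2, …, s_{n-1}`, so `VT_n` is
generated by `s_1` and the `ρ_i` with few relations. Sending `s_1` and the `ρ_i` to the two
coordinate signs gives a homomorphism onto `{±1}²` whose kernel is the commutator subgroup. For the
transversal `s_1^a ρ_1^b` the nontrivial Schreier generators of this kernel are, up to inversion,
`x_i`, `w⁻¹` and `z w⁻¹`.

Rather than rewriting relators, let a group `K` with elements in the role of these generators be
given. The formulas of the Krasner–Kaloujnine embedding define a homomorphism from `VT_n` to the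
wreath product `K ≀ {±1}²` as soon as the images of `s_1` and the `ρ_i` satisfy the relations of
`VT_n`, and those relations, read in `K`, are the listed ones. When `K` is the abstractly presented
group, the base component at `1` inverts `K → VT_n`, which is therefore injective, with image the
commutator subgroup.
-/

section GroupIdentities

variable {G : Type*} [Group G] {p q : G}

theorem mul_inv_swap_of_sq (h : (p * q⁻¹) ^ 2 = 1) : p * q⁻¹ = q * p⁻¹ := by
  simpa using eq_inv_of_mul_eq_one_left ((pow_two _).symm.trans h)

theorem zpow_mul_zpow_neg_swap_of_sq (h : (p * q⁻¹) ^ 2 = 1) (δ : ℤˣ) :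
    p ^ (δ : ℤ) * q ^ (-δ : ℤ) = q ^ (δ : ℤ) * p ^ (-δ : ℤ) := by
  have hpq := mul_inv_swap_of_sq h
  obtain rfl | rfl := Int.units_eq_one_or δ
  · simpa using hpq
  · simpa [inv_mul_eq_iff_eq_mul, ← mul_assoc, mul_inv_eq_iff_eq_mul] using hpq.symm

theorem zpow_mul_zpow_neg_mul_zpow_swap_of_cube (h : (p * q⁻¹) ^ 3 = 1) (δ : ℤˣ) :
    p ^ (δ : ℤ) * q ^ (-δ : ℤ) * p ^ (δ : ℤ) = q ^ (δ : ℤ) * p ^ (-δ : ℤ) * q ^ (δ : ℤ) := by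
  have hpq : p * q⁻¹ * p = q * p⁻¹ * q := by
    rw [← mul_inv_eq_one, ← h]
    simp only [pow_succ, pow_zero, one_mul, mul_inv_rev, inv_inv, mul_assoc]
  obtain rfl | rfl := Int.units_eq_one_or δ
  · simpa using hpq
  · simpa [mul_assoc] using congrArg (·⁻¹) hpq

theorem conj_pow_eq_one {a : G} {m : ℕ} (h : a ^ m = 1) (g : G) : (g⁻¹ * a * g) ^ m = 1 := by
  simpa [h] using conj_pow (a := g⁻¹) (b := a) (i := m)

theorem mul_mul_mul_mul_eq_of_braid {a b c : G} (hac : Commute a c)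
    (hab : a * b * a = b * a * b) (hbc : b * c * b = c * b * c) :
    b * c * (a * b) * c = a * (b * c * (a * b)) := by
  calc b * c * (a * b) * c = b * (c * a) * b * c := by simp only [mul_assoc]
    _ = b * a * (c * b * c) := by rw [← hac.eq]; simp only [mul_assoc]
    _ = b * a * b * c * b := by rw [← hbc]; simp only [mul_assoc]
    _ = a * b * (a * c) * b := by rw [← hab]; simp only [mul_assoc]
    _ = a * (b * c * (a * b)) := by rw [hac.eq]; simp only [mul_assoc]

end GroupIdentities

/-- Data identifying `K` with a subgroup of `G` by the Reidemeister–Schreier method: `θ` is the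
Krasner–Kaloujnine embedding of `G` into a wreath product attached to the transversal `T` of the
image of `φ`, and evaluating its base component at `1` inverts `φ`. -/
structure IsKrasnerKaloujnine {G K Q : Type*} [Group G] [Group K] [Group Q] (φ : K →* G)
    (θ : G →* K ≀ᵣ Q) (T : Q → G) : Prop where
  transversal_one : T 1 = 1
  mul_transversal : ∀ g q, g * T ((θ g).right⁻¹ * q) = T q * φ ((θ g).left q)
  right_map : ∀ k, (θ (φ k)).right = 1
  left_map : ∀ k, (θ (φ k)).left 1 = k

namespace IsKrasnerKaloujnine

variable {G K Q : Type*} [Group G] [Group K] [Group Q] {φ : K →* G} {θ : G →* K ≀ᵣ Q} {T : Q → G}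

theorem injective (h : IsKrasnerKaloujnine φ θ T) : Function.Injective φ :=
  Function.LeftInverse.injective (g := fun g => (θ g).left 1) h.left_map

theorem range_eq_ker (h : IsKrasnerKaloujnine φ θ T) :
    φ.range = (RegularWreathProduct.rightHom.comp θ).ker := by
  refine le_antisymm ?_ fun g hg => ⟨(θ g).left 1, ?_⟩
  · rintro _ ⟨k, rfl⟩
    exact h.right_map k
  · have hright : (θ g).right = 1 := hg
    simpa [hright, h.transversal_one] using (h.mul_transversal g 1).symm

theorem mul_transversal_of_closure {S : Set G} (hS : Subgroup.closure S = ⊤)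
    (h : ∀ g ∈ S, ∀ q, g * T ((θ g).right⁻¹ * q) = T q * φ ((θ g).left q)) (g : G) :
    ∀ q, g * T ((θ g).right⁻¹ * q) = T q * φ ((θ g).left q) := by
  induction hS ▸ Subgroup.mem_top g using Subgroup.closure_induction with
  | mem g hg => exact h g hg
  | one => simp
  | mul g g' _ _ ih ih' =>
    intro q
    simp only [map_mul, RegularWreathProduct.mul_left, RegularWreathProduct.mul_right, mul_inv_rev,
      mul_assoc, Pi.mul_apply]
    rw [ih', ← mul_assoc, ih, mul_assoc]
  | inv g _ ih =>
    intro q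
    have hg := ih ((θ g).right * q)
    simp only [inv_mul_cancel_left] at hg
    simp [inv_mul_eq_iff_eq_mul, ← mul_assoc, hg]

theorem map_of_closure {S : Set K} (hS : Subgroup.closure S = ⊤)
    (h : ∀ k ∈ S, (θ (φ k)).right = 1 ∧ (θ (φ k)).left 1 = k) (k : K) :
    (θ (φ k)).right = 1 ∧ (θ (φ k)).left 1 = k := by
  induction hS ▸ Subgroup.mem_top k using Subgroup.closure_induction with
  | mem k hk => exact h k hk
  | one => simp
  | mul k k' _ _ ih ih' => simp [ih, ih']
  | inv k _ ih => simp [ih]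

theorem of_closure {S : Set G} (hS : Subgroup.closure S = ⊤) {S' : Set K}
    (hS' : Subgroup.closure S' = ⊤) (one : T 1 = 1)
    (hT : ∀ g ∈ S, ∀ q, g * T ((θ g).right⁻¹ * q) = T q * φ ((θ g).left q))
    (hmap : ∀ k ∈ S', (θ (φ k)).right = 1 ∧ (θ (φ k)).left 1 = k) :
    IsKrasnerKaloujnine φ θ T where
  transversal_one := one
  mul_transversal := mul_transversal_of_closure hS hT
  right_map k := (map_of_closure hS' hmap k).1
  left_map k := (map_of_closure hS' hmap k).2

end IsKrasnerKaloujnine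

theorem add_two_le_or_of_two_le_abs_sub {i j : ℕ} (h : 2 ≤ |(i : ℤ) - j|) :
    i + 2 ≤ j ∨ j + 2 ≤ i := by
  rcases le_abs.1 h with h | h <;> omega

theorem eq_add_one_or_of_abs_sub_eq_one {i j : ℕ} (h : |(i : ℤ) - j| = 1) :
    j = i + 1 ∨ i = j + 1 := by
  rcases (abs_eq zero_le_one).1 h with h | h <;> omega

namespace VT

section Relations

variable {n i j : ℕ}

@[simp]
theorem s_mul_self (hi : 1 ≤ i ∧ i < n) : s i hi * s i hi = 1 := by
  rw [← pow_two]
  exact PresentedGroup.one_of_mem (IsVTRelator.s_sq ⟨i, hi⟩)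

@[simp]
theorem ρ_mul_self (hi : 1 ≤ i ∧ i < n) : ρ i hi * ρ i hi = 1 := by
  rw [← pow_two]
  exact PresentedGroup.one_of_mem (IsVTRelator.ρ_sq ⟨i, hi⟩)

@[simp]
theorem s_inv (hi : 1 ≤ i ∧ i < n) : (s i hi)⁻¹ = s i hi :=
  inv_eq_of_mul_eq_one_left (s_mul_self hi)

@[simp]
theorem ρ_inv (hi : 1 ≤ i ∧ i < n) : (ρ i hi)⁻¹ = ρ i hi :=
  inv_eq_of_mul_eq_one_left (ρ_mul_self hi)

@[simp]
theorem s_mul_s_mul (hi : 1 ≤ i ∧ i < n) (g : VT n) : s i hi * (s i hi * g) = g := by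
  rw [← mul_assoc, s_mul_self, one_mul]

@[simp]
theorem ρ_mul_ρ_mul (hi : 1 ≤ i ∧ i < n) (g : VT n) : ρ i hi * (ρ i hi * g) = g := by
  rw [← mul_assoc, ρ_mul_self, one_mul]

theorem s_comm (hi : 1 ≤ i ∧ i < n) (hj : 1 ≤ j ∧ j < n) (h : i + 2 ≤ j) :
    Commute (s i hi) (s j hj) :=
  PresentedGroup.mk_eq_mk_of_mul_inv_mem
    (IsVTRelator.s_comm ⟨i, hi⟩ ⟨j, hj⟩ (le_abs.2 (.inr (by push_cast; omega))))

theorem ρ_comm (hi : 1 ≤ i ∧ i < n) (hj : 1 ≤ j ∧ j < n) (h : i + 2 ≤ j) :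
    Commute (ρ i hi) (ρ j hj) :=
  PresentedGroup.mk_eq_mk_of_mul_inv_mem
    (IsVTRelator.ρ_comm ⟨i, hi⟩ ⟨j, hj⟩ (le_abs.2 (.inr (by push_cast; omega))))

theorem s_ρ_comm (hi : 1 ≤ i ∧ i < n) (hj : 1 ≤ j ∧ j < n) (h : i + 2 ≤ j) :
    Commute (s i hi) (ρ j hj) :=
  PresentedGroup.mk_eq_mk_of_mul_inv_mem
    (IsVTRelator.sρ_comm ⟨i, hi⟩ ⟨j, hj⟩ (le_abs.2 (.inr (by push_cast; omega))))

theorem ρ_braid (hi : 1 ≤ i ∧ i < n) (hi' : 1 ≤ i + 1 ∧ i + 1 < n) :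
    ρ i hi * ρ (i + 1) hi' * ρ i hi = ρ (i + 1) hi' * ρ i hi * ρ (i + 1) hi' :=
  PresentedGroup.mk_eq_mk_of_mul_inv_mem (IsVTRelator.ρ_braid ⟨i, hi⟩ ⟨i + 1, hi'⟩ (by simp))

theorem ρ_mul_s_succ_mul_ρ (hi : 1 ≤ i ∧ i < n) (hi' : 1 ≤ i + 1 ∧ i + 1 < n) :
    ρ i hi * s (i + 1) hi' * ρ i hi = ρ (i + 1) hi' * s i hi * ρ (i + 1) hi' :=
  PresentedGroup.mk_eq_mk_of_mul_inv_mem (IsVTRelator.mixed ⟨i, hi⟩ ⟨i + 1, hi'⟩ (by simp))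

theorem s_mul_s_pow_two (hi : 1 ≤ i ∧ i < n) (hj : 1 ≤ j ∧ j < n) (h : i + 2 ≤ j) :
    (s i hi * s j hj) ^ 2 = 1 := by
  rw [(s_comm hi hj h).mul_pow, pow_two, pow_two, s_mul_self, s_mul_self, one_mul]

theorem ρ_mul_ρ_pow_two (hi : 1 ≤ i ∧ i < n) (hj : 1 ≤ j ∧ j < n) (h : i + 2 ≤ j) :
    (ρ i hi * ρ j hj) ^ 2 = 1 := by
  rw [(ρ_comm hi hj h).mul_pow, pow_two, pow_two, ρ_mul_self, ρ_mul_self, one_mul]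

theorem ρ_mul_ρ_succ_pow_three (hi : 1 ≤ i ∧ i < n) (hi' : 1 ≤ i + 1 ∧ i + 1 < n) :
    (ρ i hi * ρ (i + 1) hi') ^ 3 = 1 := by
  calc (ρ i hi * ρ (i + 1) hi') ^ 3 =
        ρ i hi * ρ (i + 1) hi' * ρ i hi * (ρ (i + 1) hi' * ρ i hi * ρ (i + 1) hi') := by
        simp only [pow_succ, pow_zero, one_mul, mul_assoc]
    _ = 1 := by rw [ρ_braid hi hi']; simp [mul_assoc]

theorem s_succ (hi : 1 ≤ i ∧ i < n) (hi' : 1 ≤ i + 1 ∧ i + 1 < n) :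
    s (i + 1) hi' = ρ i hi * ρ (i + 1) hi' * s i hi * (ρ i hi * ρ (i + 1) hi')⁻¹ := by
  have h : ρ i hi * (ρ i hi * s (i + 1) hi' * ρ i hi) * ρ i hi = s (i + 1) hi' := by
    simp [mul_assoc]
  rw [← h, ρ_mul_s_succ_mul_ρ, mul_inv_rev, ρ_inv, ρ_inv]
  simp only [mul_assoc]

theorem s_three (hn : 4 ≤ n) :
    (s 3 : VT n) = ρ 2 * ρ 3 * (ρ 1 * ρ 2) * s 1 * (ρ 2 * ρ 3 * (ρ 1 * ρ 2))⁻¹ := by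
  rw [s_succ (i := 2) (by omega), s_succ (i := 1) (by omega) (by omega)]
  simp only [mul_inv_rev, mul_assoc]

theorem s_mem_of_s_one_mem {H : Subgroup (VT n)} (hn : 1 ≤ 1 ∧ 1 < n) (hs : s 1 hn ∈ H)
    (hρ : ∀ i hi, ρ i hi ∈ H) (hi : 1 ≤ i ∧ i < n) : s i hi ∈ H := by
  obtain ⟨h1, h2⟩ := hi
  induction i, h1 using Nat.le_induction with
  | base => exact hs
  | succ i h1 ih =>
    have hmem := H.mul_mem (hρ i ⟨h1, by omega⟩) (hρ (i + 1) ⟨by omega, h2⟩)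
    rw [s_succ ⟨h1, by omega⟩]
    exact H.mul_mem (H.mul_mem hmem (ih (by omega))) (H.inv_mem hmem)

theorem closure_s_one_ρ (hn : 2 ≤ n) :
    Subgroup.closure (insert (s 1) {g : VT n | ∃ i hi, ρ i hi = g}) = ⊤ := by
  set H := Subgroup.closure (insert (s 1) {g : VT n | ∃ i hi, ρ i hi = g})
  have hs : s 1 ∈ H := Subgroup.subset_closure (Set.mem_insert _ _)
  have hρ : ∀ i hi, ρ i hi ∈ H := fun i hi =>
    Subgroup.subset_closure (Set.mem_insert_of_mem _ ⟨i, hi, rfl⟩)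
  rw [eq_top_iff, ← PresentedGroup.closure_range_of, Subgroup.closure_le]
  rintro _ ⟨⟨i, hi⟩ | ⟨i, hi⟩, rfl⟩
  · exact s_mem_of_s_one_mem _ hs hρ hi
  · exact hρ i hi

theorem abelianization_of_ρ (hn : 1 ≤ 1 ∧ 1 < n) (hi : 1 ≤ i ∧ i < n) :
    Abelianization.of (ρ i hi) = Abelianization.of (ρ 1 hn) := by
  obtain ⟨h1, h2⟩ := hi
  induction i, h1 using Nat.le_induction with
  | base => rfl
  | succ i h1 ih =>
    have hbraid := congrArg Abelianization.of (ρ_braid ⟨h1, by omega⟩ ⟨by omega, h2⟩)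
    simp only [map_mul] at hbraid
    rw [← ih (by omega)]
    rw [mul_right_comm, mul_comm (Abelianization.of (ρ (i + 1) _)), mul_assoc, mul_assoc] at hbraid
    simpa using hbraid.symm

end Relations

/-- The words for `s_1, s_2, …` in the generators `a = s_1` and `r_i = ρ_i`, obtained from the mixed
relation by successive conjugation; the value at `0` is junk. -/
def conjSeq {G : Type*} [Group G] (a : G) (r : ℕ → G) : ℕ → G
  | 0 => a
  | 1 => a
  | (i + 2) => r (i + 1) * r (i + 2) * conjSeq a r (i + 1) * (r (i + 1) * r (i + 2))⁻¹

theorem conjSeq_succ {G : Type*} [Group G] (a : G) (r : ℕ → G) {i : ℕ} (hi : 1 ≤ i) :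
    conjSeq a r (i + 1) = r i * r (i + 1) * conjSeq a r i * (r i * r (i + 1))⁻¹ := by
  obtain ⟨i, rfl⟩ := Nat.exists_eq_add_of_le' hi
  rfl

end VT

/-- The relations of `VT_n` between `a = s_1` and `r_i = ρ_i` that remain once `s_2, …, s_{n-1}`
are eliminated by means of the mixed relations. -/
structure ReducedRelations (n : ℕ) {G : Type*} [Group G] (a : G) (r : ℕ → G) : Prop where
  a_sq : a * a = 1
  r_sq : ∀ i, 1 ≤ i → i < n → r i * r i = 1
  r_comm : ∀ i j, 1 ≤ i → i + 2 ≤ j → j < n → Commute (r i) (r j)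
  r_braid : ∀ i, 1 ≤ i → i + 1 < n → r i * r (i + 1) * r i = r (i + 1) * r i * r (i + 1)
  ar_comm : ∀ j, 3 ≤ j → j < n → Commute a (r j)
  aa_comm : 4 ≤ n → Commute a (r 2 * r 3 * (r 1 * r 2) * a * (r 2 * r 3 * (r 1 * r 2))⁻¹)

namespace ReducedRelations

open VT

variable {n i j : ℕ} {G : Type*} [Group G] {a : G} {r : ℕ → G}

theorem conjSeq_mul_self (h : ReducedRelations n a r) (hi : 1 ≤ i) :
    conjSeq a r i * conjSeq a r i = 1 := by
  induction i, hi using Nat.le_induction with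
  | base => exact h.a_sq
  | succ i hi ih =>
    rw [conjSeq_succ a r hi]
    simp only [← MulAut.conj_apply, ← map_mul, ih, map_one]

theorem commute_conjSeq_of_lt (h : ReducedRelations n a r) (hi : 1 ≤ i) (hij : i + 2 ≤ j)
    (hj : j < n) : Commute (conjSeq a r i) (r j) := by
  induction i, hi using Nat.le_induction with
  | base => exact h.ar_comm j hij hj
  | succ i hi ih =>
    have hconj : Commute (r i * r (i + 1)) (r j) :=
      (h.r_comm i j hi (by omega) hj).mul_left (h.r_comm (i + 1) j (by omega) (by omega) hj)
    rw [conjSeq_succ a r hi]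
    exact (hconj.mul_left (ih (by omega))).mul_left hconj.inv_left

theorem commute_conjSeq_add_two (h : ReducedRelations n a r) (hj : 1 ≤ j) (hjn : j + 2 < n) :
    Commute (conjSeq a r (j + 2)) (r j) := by
  set c := r (j + 1) * r (j + 2) * (r j * r (j + 1)) with hc
  have hseq : conjSeq a r (j + 2) = c * conjSeq a r j * c⁻¹ := by
    rw [conjSeq_succ a r (by omega), conjSeq_succ a r hj]
    simp only [hc, mul_assoc, mul_inv_rev]
  have hr : r j = c * r (j + 2) * c⁻¹ := by
    rw [eq_mul_inv_iff_mul_eq]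
    exact (mul_mul_mul_mul_eq_of_braid (h.r_comm j (j + 2) hj le_rfl hjn)
      (h.r_braid j hj (by omega)) (h.r_braid (j + 1) (by omega) (by omega))).symm
  rw [hseq, hr]
  exact (Commute.conj_iff c).2 (h.commute_conjSeq_of_lt hj le_rfl hjn)

theorem commute_conjSeq_of_gt (h : ReducedRelations n a r) (hj : 1 ≤ j) (hij : j + 2 ≤ i)
    (hi : i < n) : Commute (conjSeq a r i) (r j) := by
  induction i, hij using Nat.le_induction with
  | base => exact h.commute_conjSeq_add_two hj hi
  | succ i hij ih =>
    have hconj : Commute (r i * r (i + 1)) (r j) :=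
      (h.r_comm j i hj (by omega) (by omega)).symm.mul_left
        (h.r_comm j (i + 1) hj (by omega) hi).symm
    rw [conjSeq_succ a r (by omega)]
    exact (hconj.mul_left (ih (by omega))).mul_left hconj.inv_left

theorem commute_conjSeq_one (h : ReducedRelations n a r) (hj : 3 ≤ j) (hjn : j < n) :
    Commute a (conjSeq a r j) := by
  induction j, hj using Nat.le_induction with
  | base =>
    have hseq : conjSeq a r 3 = r 2 * r 3 * (r 1 * r 2) * a * (r 2 * r 3 * (r 1 * r 2))⁻¹ := by
      simp only [conjSeq, mul_assoc, mul_inv_rev]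
    exact hseq ▸ h.aa_comm (by omega)
  | succ j hj ih =>
    have hconj : Commute a (r j * r (j + 1)) :=
      (h.ar_comm j hj (by omega)).mul_right (h.ar_comm (j + 1) (by omega) hjn)
    rw [conjSeq_succ a r (by omega)]
    exact (hconj.mul_right (ih (by omega))).mul_right hconj.inv_right

theorem commute_conjSeq_conjSeq (h : ReducedRelations n a r) (hi : 1 ≤ i) (hij : i + 2 ≤ j)
    (hj : j < n) : Commute (conjSeq a r i) (conjSeq a r j) := by
  induction i, hi using Nat.le_induction with
  | base => exact h.commute_conjSeq_one hij hj
  | succ i hi ih =>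
    have hconj : Commute (r i * r (i + 1)) (conjSeq a r j) :=
      ((h.commute_conjSeq_of_gt hi (by omega) hj).mul_right
        (h.commute_conjSeq_of_gt (by omega) (by omega) hj)).symm
    rw [conjSeq_succ a r hi]
    exact (hconj.mul_left (ih (by omega))).mul_left hconj.inv_left

theorem conjSeq_mixed (h : ReducedRelations n a r) (hi : 1 ≤ i) (hin : i + 1 < n) :
    r i * conjSeq a r (i + 1) * r i = r (i + 1) * conjSeq a r i * r (i + 1) := by
  have hri := h.r_sq i hi (by omega)
  rw [conjSeq_succ a r hi, mul_inv_rev, inv_eq_of_mul_eq_one_left hri,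
    inv_eq_of_mul_eq_one_left (h.r_sq (i + 1) (by omega) hin)]
  calc _ = r i * r i * (r (i + 1) * conjSeq a r i * r (i + 1)) * (r i * r i) := by
        simp only [mul_assoc]
    _ = _ := by rw [hri, one_mul, mul_one]

/-- The images of the generators of `VT_n` under the homomorphism with `s_1 ↦ a`, `ρ_i ↦ r_i`. -/
def onGenerators (n : ℕ) (a : G) (r : ℕ → G) : VTGen n → G
  | .s i => conjSeq a r i
  | .ρ i => r i

theorem lift_onGenerators_eq_one (h : ReducedRelations n a r) (w : FreeGroup (VTGen n))
    (hw : IsVTRelator n w) : FreeGroup.lift (onGenerators n a r) w = 1 := by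
  cases hw
  all_goals simp only [VTGen.S, VTGen.R, map_mul, map_inv, FreeGroup.lift_apply_of,
    mul_inv_eq_one, pow_two, onGenerators]
  case s_sq i => exact h.conjSeq_mul_self i.2.1
  case ρ_sq i => exact h.r_sq i i.2.1 i.2.2
  case s_comm i j hij =>
    rcases add_two_le_or_of_two_le_abs_sub hij with hij | hji
    · exact h.commute_conjSeq_conjSeq i.2.1 hij j.2.2
    · exact (h.commute_conjSeq_conjSeq j.2.1 hji i.2.2).symm
  case ρ_comm i j hij =>
    rcases add_two_le_or_of_two_le_abs_sub hij with hij | hji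
    · exact h.r_comm i j i.2.1 hij j.2.2
    · exact (h.r_comm j i j.2.1 hji i.2.2).symm
  case sρ_comm i j hij =>
    rcases add_two_le_or_of_two_le_abs_sub hij with hij | hji
    · exact h.commute_conjSeq_of_lt i.2.1 hij j.2.2
    · exact h.commute_conjSeq_of_gt j.2.1 hji i.2.2
  case ρ_braid i j hij =>
    obtain ⟨⟨i, hi⟩, ⟨j, hj⟩⟩ := i, j
    obtain rfl | rfl := eq_add_one_or_of_abs_sub_eq_one hij
    · exact h.r_braid i hi.1 hj.2
    · exact (h.r_braid j hj.1 hi.2).symm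
  case mixed i j hij =>
    obtain ⟨⟨i, hi⟩, ⟨j, hj⟩⟩ := i, j
    obtain rfl | rfl := eq_add_one_or_of_abs_sub_eq_one hij
    · exact h.conjSeq_mixed hi.1 hj.2
    · exact (h.conjSeq_mixed hj.1 hi.2).symm

/-- The homomorphism from `VT_n` determined by images of `s_1` and the `ρ_i` that satisfy the
reduced relations. -/
def lift (h : ReducedRelations n a r) : VT n →* G :=
  PresentedGroup.toGroup h.lift_onGenerators_eq_one

@[simp]
theorem lift_ρ (h : ReducedRelations n a r) (hi : 1 ≤ i ∧ i < n) : h.lift (ρ i hi) = r i :=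
  PresentedGroup.toGroup.of h.lift_onGenerators_eq_one

@[simp]
theorem lift_s_one (h : ReducedRelations n a r) (hn : 1 ≤ 1 ∧ 1 < n) : h.lift (s 1 hn) = a :=
  PresentedGroup.toGroup.of h.lift_onGenerators_eq_one

end ReducedRelations

section SchreierGenerators

variable {K : Type*} [Group K]

/-- The value at `(ε, δ)` of the base component of `ρ_2 ρ_3 ρ_1 ρ_2` in the wreath product, where
`y ε i` is the Schreier generator attached to `ρ_i`. Conjugation by this element shifts `s_1` to
`s_3`. -/
def shiftWord (y : ℤˣ → ℕ → K) (ε δ : ℤˣ) : K :=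
  y ε 2 ^ (δ : ℤ) * y ε 3 ^ (-δ : ℤ) * (y ε 1 ^ (δ : ℤ) * y ε 2 ^ (-δ : ℤ))

/-- The relations satisfied by the Schreier generators
`y ε i = (s_1^a)⁻¹ ρ_i (s_1^a ρ_1)`, where `ε = (-1)^a`, of the kernel of the sign
homomorphism `VT_n → {±1}²`. The field `conj_comm` says that `s_1` commutes with `s_3`. -/
structure SchreierRelations (n : ℕ) (y : ℤˣ → ℕ → K) : Prop where
  one : y 1 1 = 1
  neg_eq : ∀ j, 3 ≤ j → j < n → y (-1) j = y 1 j
  sq : ∀ ε i j, 1 ≤ i → i + 2 ≤ j → j < n → (y ε i * (y ε j)⁻¹) ^ 2 = 1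
  cube : ∀ ε i, 1 ≤ i → i + 1 < n → (y ε i * (y ε (i + 1))⁻¹) ^ 3 = 1
  conj_comm : 4 ≤ n → ∀ δ, (shiftWord y (-1) δ * (shiftWord y 1 δ)⁻¹) ^ 2 = 1

namespace SchreierRelations

/-- The wreath product element that changes the second sign, with base component
`(ε, δ) ↦ c ε ^ δ`. -/
def signFlip (c : ℤˣ → K) : K ≀ᵣ (ℤˣ × ℤˣ) :=
  ⟨fun q => c q.1 ^ (q.2 : ℤ), (1, -1)⟩

@[simp]
theorem signFlip_mul_self (c : ℤˣ → K) : signFlip c * signFlip c = 1 := by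
  ext q <;> simp [signFlip]

theorem commute_signFlip {c d : ℤˣ → K} (h : ∀ ε, (c ε * (d ε)⁻¹) ^ 2 = 1) :
    Commute (signFlip c) (signFlip d) := by
  ext q
  · simpa [signFlip] using zpow_mul_zpow_neg_swap_of_sq (h q.1) q.2
  all_goals rfl

theorem signFlip_braid {c d : ℤˣ → K} (h : ∀ ε, (c ε * (d ε)⁻¹) ^ 3 = 1) :
    signFlip c * signFlip d * signFlip c = signFlip d * signFlip c * signFlip d := by
  ext q
  · simpa [signFlip] using zpow_mul_zpow_neg_mul_zpow_swap_of_cube (h q.1) q.2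
  all_goals rfl

theorem inl_mul_inl_self :
    (RegularWreathProduct.inl (-1, 1) * RegularWreathProduct.inl (-1, 1) : K ≀ᵣ (ℤˣ × ℤˣ)) = 1 := by
  ext q <;> simp

theorem commute_inl_signFlip {c : ℤˣ → K} (h : c (-1) = c 1) :
    Commute (RegularWreathProduct.inl (-1, 1)) (signFlip c) := by
  ext q
  · obtain hq | hq := Int.units_eq_one_or q.1 <;> simp [signFlip, hq, h]
  all_goals simp [signFlip]

theorem commute_inl_conj {f : ℤˣ × ℤˣ → K}
    (h : ∀ δ, (f (-1, δ) * (f (1, δ))⁻¹) ^ 2 = 1) :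
    Commute (RegularWreathProduct.inl (-1, 1)) ((⟨f, 1⟩ : K ≀ᵣ (ℤˣ × ℤˣ)) *
      RegularWreathProduct.inl (-1, 1) * (⟨f, 1⟩ : K ≀ᵣ (ℤˣ × ℤˣ))⁻¹) := by
  ext q
  · obtain ⟨ε, δ⟩ := q
    obtain rfl | rfl := Int.units_eq_one_or ε <;> simp [mul_inv_swap_of_sq (h δ)]
  all_goals simp

theorem signFlip_mul_four (y : ℤˣ → ℕ → K) :
    signFlip (y · 2) * signFlip (y · 3) * (signFlip (y · 1) * signFlip (y · 2)) =
      ⟨fun q => shiftWord y q.1 q.2, 1⟩ := by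
  ext q <;> simp [signFlip, shiftWord]

theorem reducedRelations {n : ℕ} {y : ℤˣ → ℕ → K} (h : SchreierRelations n y) :
    ReducedRelations n (RegularWreathProduct.inl (-1, 1) : K ≀ᵣ (ℤˣ × ℤˣ))
      (fun i => signFlip (y · i)) where
  a_sq := inl_mul_inl_self
  r_sq _ _ _ := signFlip_mul_self _
  r_comm i j hi hij hj := commute_signFlip fun ε => h.sq ε i j hi hij hj
  r_braid i hi hin := signFlip_braid fun ε => h.cube ε i hi hin
  ar_comm j hj hjn := commute_inl_signFlip (h.neg_eq j hj hjn)
  aa_comm hn := by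
    rw [signFlip_mul_four]
    exact commute_inl_conj (h.conj_comm hn)

end SchreierRelations

end SchreierGenerators

namespace VT

variable {n : ℕ}

/-- The transversal `{1, s_1} · {1, ρ_1}` of the commutator subgroup of `VT_n`, indexed by signs:
`((-1)^a, (-1)^b) ↦ s_1^a ρ_1^b`. -/
def transversal (hn : 2 ≤ n) (q : ℤˣ × ℤˣ) : VT n :=
  (if q.1 = 1 then 1 else s 1) * (if q.2 = 1 then 1 else ρ 1)

theorem transversal_one (hn : 2 ≤ n) : transversal hn 1 = 1 := by
  simp [transversal]

theorem transversal_neg_left (hn : 2 ≤ n) (ε δ : ℤˣ) :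
    transversal hn (-ε, δ) = s 1 * transversal hn (ε, δ) := by
  obtain rfl | rfl := Int.units_eq_one_or ε <;> simp [transversal]

theorem transversal_neg_right (hn : 2 ≤ n) (ε δ : ℤˣ) :
    transversal hn (ε, -δ) = transversal hn (ε, δ) * ρ 1 := by
  obtain rfl | rfl := Int.units_eq_one_or δ <;> simp [transversal, mul_assoc]

/-- The Schreier generator attached to the coset of `s_1^a`, where `ε = (-1)^a`, and to `ρ_i`. -/
def schreierGen (hn : 2 ≤ n) (ε : ℤˣ) (i : ℕ) (hi : 1 ≤ i ∧ i < n) : VT n :=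
  (transversal hn (ε, 1))⁻¹ * ρ i hi * transversal hn (ε, -1)

theorem schreierGen_zpow (hn : 2 ≤ n) (ε δ : ℤˣ) {i : ℕ} (hi : 1 ≤ i ∧ i < n) :
    schreierGen hn ε i hi ^ (δ : ℤ) =
      (transversal hn (ε, δ))⁻¹ * ρ i hi * transversal hn (ε, -δ) := by
  obtain rfl | rfl := Int.units_eq_one_or δ <;> simp [schreierGen, mul_assoc]

theorem schreierGen_mul_inv (hn : 2 ≤ n) (ε : ℤˣ) {i j : ℕ} (hi : 1 ≤ i ∧ i < n)
    (hj : 1 ≤ j ∧ j < n) : schreierGen hn ε i hi * (schreierGen hn ε j hj)⁻¹ =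
      (transversal hn (ε, 1))⁻¹ * (ρ i hi * ρ j hj) * transversal hn (ε, 1) := by
  simp [schreierGen, mul_assoc]

theorem schreierGen_mem_commutator (hn : 2 ≤ n) (ε : ℤˣ) {i : ℕ} (hi : 1 ≤ i ∧ i < n) :
    schreierGen hn ε i hi ∈ commutator (VT n) := by
  have hρ : Abelianization.of (ρ 1 : VT n) * Abelianization.of (ρ 1) = 1 := by
    rw [← map_mul, ρ_mul_self, map_one]
  rw [← Abelianization.ker_of, MonoidHom.mem_ker, schreierGen, transversal_neg_right]
  simp only [map_mul, map_inv, abelianization_of_ρ (by omega) hi]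
  rw [mul_right_comm, ← mul_assoc, mul_assoc, hρ]
  simp

theorem shiftWord_of_schreierGen {y : ℤˣ → ℕ → VT n} (hn : 2 ≤ n) (hn' : 4 ≤ n)
    (hy : ∀ ε i hi, y ε i = schreierGen hn ε i hi) (ε δ : ℤˣ) :
    shiftWord y ε δ =
      (transversal hn (ε, δ))⁻¹ * (ρ 2 * ρ 3 * (ρ 1 * ρ 2)) * transversal hn (ε, δ) := by
  simp only [shiftWord, hy ε 1 (by omega), hy ε 2 (by omega), hy ε 3 (by omega), ← Units.val_neg,
    schreierGen_zpow]
  simp [mul_assoc]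

theorem schreierRelations {y : ℤˣ → ℕ → VT n} (hn : 2 ≤ n)
    (hy : ∀ ε i hi, y ε i = schreierGen hn ε i hi) : SchreierRelations n y where
  one := by simp [hy 1 1 (by omega), schreierGen, transversal]
  neg_eq j hj hjn := by
    rw [hy _ j (by omega), hy _ j (by omega)]
    simp [schreierGen, transversal, mul_assoc, (s_ρ_comm (n := n) (i := 1) _ _ hj).left_comm]
  sq ε i j hi hij hj := by
    rw [hy ε i (by omega), hy ε j (by omega), schreierGen_mul_inv]
    exact conj_pow_eq_one (ρ_mul_ρ_pow_two _ _ hij) _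
  cube ε i hi hin := by
    rw [hy ε i (by omega), hy ε (i + 1) (by omega), schreierGen_mul_inv]
    exact conj_pow_eq_one (ρ_mul_ρ_succ_pow_three _ _) _
  conj_comm hn' δ := by
    have hs : ((s 1 : VT n) * s 3) ^ 2 = 1 := s_mul_s_pow_two _ _ le_rfl
    simp only [shiftWord_of_schreierGen hn hn' hy, transversal_neg_left]
    simpa [s_three hn', mul_assoc] using conj_pow_eq_one hs (transversal hn (1, δ))

end VT

namespace SchreierRelations

open VT

variable {n : ℕ} {K : Type*} [Group K] {y : ℤˣ → ℕ → K} {φ : K →* VT n}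

theorem isKrasnerKaloujnine (h : SchreierRelations n y) (hn : 2 ≤ n)
    (hy : Subgroup.closure {k | ∃ ε i, (1 ≤ i ∧ i < n) ∧ y ε i = k} = ⊤)
    (hφ : ∀ ε i hi, φ (y ε i) = schreierGen hn ε i hi) :
    IsKrasnerKaloujnine φ h.reducedRelations.lift (transversal hn) := by
  refine .of_closure (closure_s_one_ρ hn) hy (transversal_one hn) ?_ ?_
  · rintro _ (rfl | ⟨i, hi, rfl⟩) ⟨ε, δ⟩
    · simp [transversal_neg_left]
    · simp [signFlip, hφ _ _ hi, schreierGen_zpow, mul_assoc]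
  · rintro _ ⟨ε, i, hi, rfl⟩
    rw [hφ ε i hi]
    obtain rfl | rfl := Int.units_eq_one_or ε <;>
      simp [schreierGen, transversal, signFlip, h.one]

theorem range_eq_commutator (h : SchreierRelations n y) (hn : 2 ≤ n)
    (hy : Subgroup.closure {k | ∃ ε i, (1 ≤ i ∧ i < n) ∧ y ε i = k} = ⊤)
    (hφ : ∀ ε i hi, φ (y ε i) = schreierGen hn ε i hi) : φ.range = commutator (VT n) := by
  refine le_antisymm ?_ ?_
  · rw [MonoidHom.range_eq_map, ← hy, MonoidHom.map_closure, Subgroup.closure_le]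
    rintro _ ⟨_, ⟨ε, i, hi, rfl⟩, rfl⟩
    exact hφ ε i hi ▸ schreierGen_mem_commutator hn ε hi
  · rw [(h.isKrasnerKaloujnine hn hy hφ).range_eq_ker]
    exact Abelianization.commutator_subset_ker _

theorem exists_mulEquiv_commutator (h : SchreierRelations n y) (hn : 2 ≤ n)
    (hy : Subgroup.closure {k | ∃ ε i, (1 ≤ i ∧ i < n) ∧ y ε i = k} = ⊤)
    (hφ : ∀ ε i hi, φ (y ε i) = schreierGen hn ε i hi) :
    ∃ e : K ≃* commutator (VT n), ∀ k, (e k : VT n) = φ k :=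
  ⟨(MonoidHom.ofInjective (h.isKrasnerKaloujnine hn hy hφ).injective).trans
    (MulEquiv.subgroupCongr (h.range_eq_commutator hn hy hφ)), fun _ => rfl⟩

end SchreierRelations

namespace VTCommGen

open VT

variable {n : ℕ}

/-- The word in the letters `x_i`, `z`, `w` that represents `VT.schreierGen` at the sign `ε` and
`ρ_i`, for `1 ≤ i ≤ n - 1`; the values at other `i` are junk. -/
def word (n : ℕ) (ε : ℤˣ) (i : ℕ) : FreeGroup (VTCommGen n) :=
  if ε = 1 ∨ 3 ≤ i then if h : 2 ≤ i ∧ i < n then X i h else 1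
  else if i = 1 then W⁻¹ else Z * W⁻¹

@[simp]
theorem word_one_one : word n 1 1 = 1 := by simp [word]

theorem word_one {i : ℕ} (hi : 2 ≤ i ∧ i < n) : word n 1 i = X i hi := by simp [word, hi]

theorem word_of_three_le (ε : ℤˣ) {i : ℕ} (h3 : 3 ≤ i) (hi : i < n) : word n ε i = X i := by
  simp [word, h3, hi, (by omega : 2 ≤ i)]

@[simp]
theorem word_neg_one_one : word n (-1) 1 = W⁻¹ := by simp [word]

@[simp]
theorem word_neg_one_two : word n (-1) 2 = Z * W⁻¹ := by simp [word]

theorem lift_toVT_word (hn : 3 ≤ n) (ε : ℤˣ) (i : ℕ) (hi : 1 ≤ i ∧ i < n) :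
    FreeGroup.lift (toVT n hn) (word n ε i) = schreierGen (by omega) ε i hi := by
  obtain h3 | rfl | rfl : 3 ≤ i ∨ i = 2 ∨ i = 1 := by omega
  · have hcomm := (s_ρ_comm (n := n) (i := 1) (by omega) hi h3).left_comm
    rw [word_of_three_le ε h3 hi.2]
    obtain rfl | rfl := Int.units_eq_one_or ε <;>
      simp [X, toVT, schreierGen, transversal, mul_assoc, hcomm]
  all_goals
    obtain rfl | rfl := Int.units_eq_one_or ε <;>
      simp [word_one, hi, X, Z, W, toVT, schreierGen, transversal, mul_assoc, pow_two]

theorem closure_map_word (hn : 3 ≤ n) {H : Type*} [Group H] (f : FreeGroup (VTCommGen n) →* H)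
    (hf : Function.Surjective f) :
    Subgroup.closure {k | ∃ ε i, (1 ≤ i ∧ i < n) ∧ f (word n ε i) = k} = ⊤ := by
  set N := Subgroup.closure {k | ∃ ε i, (1 ≤ i ∧ i < n) ∧ f (word n ε i) = k}
  have hword : ∀ ε i, 1 ≤ i ∧ i < n → f (word n ε i) ∈ N := fun ε i hi =>
    Subgroup.subset_closure ⟨ε, i, hi, rfl⟩
  have hW : f W ∈ N := by simpa using N.inv_mem (hword (-1) 1 (by omega))
  rw [eq_top_iff, ← Subgroup.map_top_of_surjective f hf, ← FreeGroup.closure_range_of,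
    MonoidHom.map_closure, Subgroup.closure_le]
  rintro _ ⟨_, ⟨⟨i, hi⟩ | _ | _, rfl⟩, rfl⟩
  · simpa only [word_one hi] using! hword 1 i (by omega)
  · simpa [Z] using N.mul_mem (hword (-1) 2 (by omega)) hW
  · exact hW

theorem hasPresentation_commutator (hn : 3 ≤ n) {R : Set (FreeGroup (VTCommGen n))}
    (hR : ∀ {H : Type} [Group H] (f : FreeGroup (VTCommGen n) →* H),
      (∀ r ∈ R, f r = 1) ↔ SchreierRelations n fun ε i => f (word n ε i)) :
    (commutator (VT n)).HasPresentation (toVT n hn) R := by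
  have hn2 : 2 ≤ n := by omega
  have hVT := (hR (FreeGroup.lift (toVT n hn))).2 (schreierRelations hn2 (lift_toVT_word hn))
  have hK := (hR (PresentedGroup.mk R)).1 fun r hr => PresentedGroup.one_of_mem hr
  obtain ⟨e, he⟩ := hK.exists_mulEquiv_commutator (φ := PresentedGroup.toGroup hVT) hn2
    (closure_map_word hn _ (PresentedGroup.mk_surjective R)) (lift_toVT_word hn)
  exact ⟨e, fun a => (he _).trans (PresentedGroup.toGroup.of hVT)⟩

section Relators

variable {H : Type*} [Group H] {f : FreeGroup (VTCommGen n) →* H}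

theorem schreierRelations_of_isRelator (hn : 4 ≤ n) (h : ∀ r, IsRelator n hn r → f r = 1) :
    SchreierRelations n fun ε i => f (word n ε i) where
  one := by simp
  neg_eq j h3 hj := by rw [word_of_three_le _ h3 hj, word_of_three_le _ h3 hj]
  sq ε i j hi hij hj := by
    rw [word_of_three_le ε (by omega) hj]
    obtain rfl | rfl := Int.units_eq_one_or ε
    · obtain rfl | h2 : i = 1 ∨ 2 ≤ i := by omega
      · simpa using h _ (.rel2 j (by omega) hj)
      · simpa [word_one (show 2 ≤ i ∧ i < n by omega)] using h _ (.rel5 i j h2 hij hj)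
    · obtain rfl | rfl | h3 : i = 1 ∨ i = 2 ∨ 3 ≤ i := by omega
      · simpa [← mul_inv_rev] using h _ (.rel6 j (by omega) hj)
      · simpa using h _ (.rel8 j (by omega) hj)
      · simpa [word_of_three_le _ h3 (by omega : i < n)] using h _ (.rel5 i j (by omega) hij hj)
  cube ε i hi hin := by
    obtain rfl | rfl := Int.units_eq_one_or ε
    · rw [word_one (i := i + 1) (by omega)]
      obtain rfl | h2 : i = 1 ∨ 2 ≤ i := by omega
      · simpa using h _ .rel1
      · simpa [word_one (show 2 ≤ i ∧ i < n by omega)] using h _ (.rel4 i h2 hin)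
    · obtain rfl | h2 : i = 1 ∨ 2 ≤ i := by omega
      · simpa using h _ .rel3
      rw [word_of_three_le (i := i + 1) _ (by omega) hin]
      obtain rfl | h3 : i = 2 ∨ 3 ≤ i := by omega
      · simpa using h _ .rel7
      · simpa [word_of_three_le _ h3 (by omega : i < n)] using h _ (.rel4 i h2 hin)
  conj_comm _ δ := by
    have hX2 : word n 1 2 = X 2 := word_one (by omega)
    have hX3 : ∀ ε, word n ε 3 = X 3 := fun ε => word_of_three_le ε le_rfl (by omega)
    obtain rfl | rfl := Int.units_eq_one_or δ
    · simpa [shiftWord, hX2, hX3, mul_assoc] using h _ .rel9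
    · simpa [shiftWord, hX2, hX3, mul_assoc] using h _ .rel10

theorem map_eq_one_of_schreierRelations (hn : 4 ≤ n)
    (h : SchreierRelations n fun ε i => f (word n ε i)) (r : FreeGroup (VTCommGen n))
    (hr : IsRelator n hn r) : f r = 1 := by
  have hX2 : word n 1 2 = X 2 := word_one (by omega)
  have hX3 : ∀ ε, word n ε 3 = X 3 := fun ε => word_of_three_le ε le_rfl (by omega)
  cases hr with
  | rel1 => simpa [hX2] using h.cube 1 1 le_rfl (by omega)
  | rel2 j h3 hj =>
    simpa [word_one, (by omega : 2 ≤ j), hj] using h.sq 1 1 j le_rfl (by omega) hj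
  | rel3 => simpa using h.cube (-1) 1 le_rfl (by omega)
  | rel4 i h2 hi =>
    simpa [word_one (show 2 ≤ i ∧ i < n by omega),
      word_one (show 2 ≤ i + 1 ∧ i + 1 < n by omega)] using h.cube 1 i (by omega) hi
  | rel5 i j h2 hij hj =>
    simpa [word_one (show 2 ≤ i ∧ i < n by omega),
      word_one (show 2 ≤ j ∧ j < n by omega)] using h.sq 1 i j (by omega) hij hj
  | rel6 j h3 hj =>
    simpa [word_of_three_le _ h3 hj, ← mul_inv_rev] using h.sq (-1) 1 j le_rfl (by omega) hj
  | rel7 => simpa [hX3] using h.cube (-1) 2 (by omega) (by omega)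
  | rel8 j h4 hj =>
    simpa [word_of_three_le _ (by omega : 3 ≤ j) hj] using h.sq (-1) 2 j (by omega) h4 hj
  | rel9 => simpa [shiftWord, hX2, hX3, mul_assoc] using h.conj_comm hn 1
  | rel10 => simpa [shiftWord, hX2, hX3, mul_assoc] using h.conj_comm hn (-1)

/-- The relators `x_2 ^ p` and `z ^ q` on the three generators for `n = 3`. -/
def powRelators (p q : ℕ) : Set (FreeGroup (VTCommGen 3)) :=
  {X 2 ⟨le_rfl, Nat.lt_add_one 2⟩ ^ p, Z ^ q}

theorem schreierRelations_three_iff {f : FreeGroup (VTCommGen 3) →* H} :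
    (∀ r ∈ powRelators 3 3, f r = 1) ↔ SchreierRelations 3 fun ε i => f (word 3 ε i) := by
  simp only [powRelators, Set.mem_insert_iff, Set.mem_singleton_iff, forall_eq_or_imp, forall_eq]
  constructor
  · rintro ⟨hX, hZ⟩
    refine ⟨by simp, by omega, by omega, fun ε i hi hi3 => ?_, by omega⟩
    obtain rfl : i = 1 := by omega
    obtain rfl | rfl := Int.units_eq_one_or ε
    · simpa [word_one] using hX
    · simpa using hZ
  · intro h
    have hX := h.cube 1 1 le_rfl (by omega)
    have hZ := h.cube (-1) 1 le_rfl (by omega)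
    exact ⟨by simpa [word_one] using hX, by simpa using hZ⟩

end Relators

end VTCommGen

section CyclicGroups

variable {G : Type*} [Group G] {m : ℕ}

theorem mem_zpowers_ofAdd_one (k : Multiplicative (ZMod m)) :
    k ∈ Subgroup.zpowers (Multiplicative.ofAdd (1 : ZMod m)) :=
  ⟨k.toAdd.cast, by simp [← ofAdd_zsmul]⟩

theorem multiplicative_zmod_hom_ext {f f' : Multiplicative (ZMod m) →* G}
    (h : f (Multiplicative.ofAdd 1) = f' (Multiplicative.ofAdd 1)) : f = f' :=
  (MonoidHom.eq_iff_eq_on_generator mem_zpowers_ofAdd_one f f').2 h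

theorem ofAdd_one_pow (m : ℕ) : Multiplicative.ofAdd (1 : ZMod m) ^ m = 1 := by
  simp [← ofAdd_nsmul]

/-- The homomorphism from the cyclic group `ℤ/m` to `G` that sends the generator to `g`, for
`g ^ m = 1`; this is `zpowersHom` modulo `m`. -/
noncomputable def zmodPowersHom (g : G) (h : g ^ m = 1) : Multiplicative (ZMod m) →* G :=
  monoidHomOfForallMemZpowers (g' := g) mem_zpowers_ofAdd_one <| by
    rw [orderOf_ofAdd_eq_addOrderOf, ZMod.addOrderOf_one]
    exact orderOf_dvd_of_pow_eq_one h

@[simp]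
theorem zmodPowersHom_ofAdd_one (g : G) (h : g ^ m = 1) :
    zmodPowersHom g h (Multiplicative.ofAdd 1) = g :=
  monoidHomOfForallMemZpowers_apply_gen _ _

end CyclicGroups

namespace VTCommGen

open Monoid

variable {p q : ℕ}

/-- The free product `ℤ/p * ℤ/q * ℤ`. -/
abbrev CyclicCoprod (p q : ℕ) : Type :=
  Coprod (Coprod (Multiplicative (ZMod p)) (Multiplicative (ZMod q))) (Multiplicative ℤ)

/-- The images in the free product `ℤ/p * ℤ/q * ℤ` of the three generators for `n = 3`. -/
def toCoprod (p q : ℕ) : VTCommGen 3 → CyclicCoprod p q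
  | x _ => Coprod.inl (Coprod.inl (Multiplicative.ofAdd 1))
  | z => Coprod.inl (Coprod.inr (Multiplicative.ofAdd 1))
  | w => Coprod.inr (Multiplicative.ofAdd 1)

theorem lift_toCoprod_eq_one (r : FreeGroup (VTCommGen 3)) (hr : r ∈ powRelators p q) :
    FreeGroup.lift (toCoprod p q) r = 1 := by
  obtain rfl | rfl := hr
  · rw [map_pow, X, FreeGroup.lift_apply_of, toCoprod, ← map_pow, ← map_pow, ofAdd_one_pow,
      map_one, map_one]
  · rw [map_pow, Z, FreeGroup.lift_apply_of, toCoprod, ← map_pow, ← map_pow, ofAdd_one_pow,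
      map_one, map_one]

theorem of_x_pow : (PresentedGroup.of (x ⟨2, le_rfl, Nat.lt_add_one 2⟩) :
    PresentedGroup (powRelators p q)) ^ p = 1 :=
  PresentedGroup.one_of_mem (Set.mem_insert _ _)

theorem of_z_pow : (PresentedGroup.of z : PresentedGroup (powRelators p q)) ^ q = 1 :=
  PresentedGroup.one_of_mem (Set.mem_insert_of_mem _ (Set.mem_singleton _))

/-- The group `⟨x, z, w ∣ x ^ p = z ^ q = 1⟩` is the free product `ℤ/p * ℤ/q * ℤ`. -/
noncomputable def presentedEquivCoprod (p q : ℕ) :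
    PresentedGroup (powRelators p q) ≃* CyclicCoprod p q :=
  MonoidHom.toMulEquiv (PresentedGroup.toGroup lift_toCoprod_eq_one)
    (Coprod.lift (Coprod.lift (zmodPowersHom _ of_x_pow) (zmodPowersHom _ of_z_pow))
      (zpowersHom _ (PresentedGroup.of w)))
    (by
      refine PresentedGroup.ext ?_
      rintro (⟨i, hi⟩ | _ | _)
      · obtain rfl : i = 2 := by omega
        simp [toCoprod]
      all_goals simp [toCoprod])
    (by
      refine Coprod.hom_ext (Coprod.hom_ext ?_ ?_) ?_
      · apply multiplicative_zmod_hom_ext (G := CyclicCoprod p q)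
        simp [toCoprod]
      · apply multiplicative_zmod_hom_ext (G := CyclicCoprod p q)
        simp [toCoprod]
      · apply MonoidHom.ext_mint (M := CyclicCoprod p q)
        simp [toCoprod])

theorem hasPresentation_three :
    (commutator (VT 3)).HasPresentation (toVT 3 le_rfl) (powRelators 3 3) :=
  hasPresentation_commutator le_rfl fun _ => schreierRelations_three_iff

theorem hasPresentation_of_four_le {n : ℕ} (hn : 4 ≤ n) :
    (commutator (VT n)).HasPresentation (toVT n (Nat.le_of_succ_le hn)) {r | IsRelator n hn r} :=
  hasPresentation_commutator _ fun _ =>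
    ⟨schreierRelations_of_isRelator hn, map_eq_one_of_schreierRelations hn⟩

end VTCommGen

namespace VT

/-- The Schreier generators of the commutator subgroup of `VT_2`, when it is identified with `ℤ`
so that `(ρ_1 s_1)²` corresponds to `1`. -/
def schreierGenTwo (ε : ℤˣ) (_ : ℕ) : Multiplicative ℤ :=
  if ε = 1 then 1 else Multiplicative.ofAdd (-1)

theorem schreierRelations_two : SchreierRelations 2 schreierGenTwo where
  one := rfl
  neg_eq := by omega
  sq := by omega
  cube := by omega
  conj_comm := by omega

theorem closure_schreierGenTwo :
    Subgroup.closure {k | ∃ ε i, (1 ≤ i ∧ i < 2) ∧ schreierGenTwo ε i = k} = ⊤ := by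
  refine eq_top_iff.2 fun k _ => ?_
  have hk : schreierGenTwo (-1) 1 ^ (-k.toAdd) = k := by simp [schreierGenTwo, ← ofAdd_zsmul]
  have hmem : schreierGenTwo (-1) 1 ∈
      Subgroup.closure {k | ∃ ε i, (1 ≤ i ∧ i < 2) ∧ schreierGenTwo ε i = k} :=
    Subgroup.subset_closure ⟨-1, 1, by omega, rfl⟩
  exact hk ▸ Subgroup.zpow_mem _ hmem (-k.toAdd)

theorem zpowersHom_schreierGenTwo (ε : ℤˣ) (i : ℕ) (hi : 1 ≤ i ∧ i < 2) :
    zpowersHom (VT 2) ((ρ 1 ⟨le_rfl, one_lt_two⟩ * s 1 ⟨le_rfl, one_lt_two⟩) ^ 2)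
      (schreierGenTwo ε i) = schreierGen le_rfl ε i hi := by
  obtain rfl : i = 1 := by omega
  obtain rfl | rfl := Int.units_eq_one_or ε <;>
    simp [schreierGenTwo, schreierGen, transversal, pow_two, mul_assoc]

theorem commutator_two_eq_zpowers :
    commutator (VT 2) =
      Subgroup.zpowers ((ρ 1 ⟨le_rfl, one_lt_two⟩ * s 1 ⟨le_rfl, one_lt_two⟩ : VT 2) ^ 2) :=
  (schreierRelations_two.range_eq_commutator le_rfl
    (φ := zpowersHom (VT 2) ((ρ 1 * s 1) ^ 2)) closure_schreierGenTwo
    zpowersHom_schreierGenTwo).symm.trans (Subgroup.ext fun _ => Iff.rfl)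

theorem nonempty_commutator_two_mulEquiv : Nonempty (commutator (VT 2) ≃* Multiplicative ℤ) :=
  have ⟨e, _⟩ := schreierRelations_two.exists_mulEquiv_commutator le_rfl
    (φ := zpowersHom (VT 2) ((ρ 1 * s 1) ^ 2)) closure_schreierGenTwo zpowersHom_schreierGenTwo
  ⟨e.symm⟩

end VT

theorem mainTheorem2 :
    (Nonempty (commutator (VT 2) ≃* Multiplicative ℤ) ∧
      commutator (VT 2) = Subgroup.zpowers ((VT.ρ 1 * VT.s 1 : VT 2) ^ 2)) ∧
    (Nonempty (commutator (VT 3) ≃*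
        Monoid.Coprod (Monoid.Coprod (Multiplicative (ZMod 3)) (Multiplicative (ZMod 3)))
          (Multiplicative ℤ)) ∧
      (commutator (VT 3)).HasPresentation (VTCommGen.toVT 3 le_rfl)
        {VTCommGen.X 2 ^ 3, VTCommGen.Z ^ 3}) ∧
    (∀ (n : ℕ) (hn : 4 ≤ n),
      (commutator (VT n)).HasPresentation (VTCommGen.toVT n (by omega))
        {r | VTCommGen.IsRelator n hn r}) := by
  refine ⟨⟨VT.nonempty_commutator_two_mulEquiv, VT.commutator_two_eq_zpowers⟩,
    ⟨?_, VTCommGen.hasPresentation_three⟩, fun n hn => VTCommGen.hasPresentation_of_four_le hn⟩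
  obtain ⟨e, -⟩ := VTCommGen.hasPresentation_three
  exact ⟨e.symm.trans (VTCommGen.presentedEquivCoprod 3 3)⟩
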